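/- Conventions. For a semigroup $S$ let $S^1$ be $S$ with an identity adjoined (if it has none). For $x,y\in S$ and $z_1,z_2,\ldots\in S^1$ put $\lambda_0=x$, $\rho_0=y$, $\lambda_{n+1}=\lambda_n z_{n+1}\rho_n$ and $\rho_{n+1}=\rho_n z_{n+1}\lambda_n$. Let $\eta_1$ be equality on $S$; for $n>1$ let $x\,\eta_n\,y$ mean that there are $z_1,\ldots,z_n\in S^1$ with $x=\lambda_n(x,y,z_1,\ldots,z_n)$ and $y=\rho_n(x,y,z_1,\ldots,z_n)$. Let $\eta$ be the transitive closure of $\bigcup_{n\ge 1}\eta_n$, and let $\eta^{*}$ be the smallest congruence on $S$ that contains $\eta$. Let $G$ be a finite group, $n,m$ positive integers and $P=(p_{j,i})$ an $m\times n$ matrix over $G\cup\{\theta\}$. The Rees matrix semigroup $\mathcal M^0(G,n,m;P)$ consists of a zero $\theta$ and the triples $(g;i,j)$ with $g\in G$, $1\le i\le n$, $1\le j\le m$, with $(g;i,j)(h;k,l)=(g\,p_{j,k}h;i,l)$ if $p_{j,k}\ne\theta$ and $(g;i,j)(h;k,l)=\theta$ otherwise. It is regular if no row and no column of $P$ consists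 of zeros only. If no entry of $P$ is $\theta$, the triples alone form the completely simple semigroup $\mathcal M(G,n,m;P)$. A regular $\mathcal M^0(G,n,m;P)$ is called CS-diagonal if $p_{r,t}\ne\theta$, $p_{r',t}\ne\theta$ and $p_{r,t'}\neq\theta$ always imply $p_{r',t'}\ne\theta$; a completely simple semigroup $\mathcal M(G,n,m;P)$ is CS-diagonal, since no entry of $P$ is $\theta$. A semigroup is CS-diagonal if it is isomorphic to one of these. A semigroup is null if it has a zero that equals all products; in particular the one-element semigroup is null. Let $S$ be a finite semigroup with a principal series $S=S_1\supset S_2\supset\cdots\supset S_o\supset S_{o+1}=\emptyset$, that is, each $S_p$ is an ideal (the empty set counts as one), the inclusions are strict, and no ideal of $S$ lies strictly between $S_p$ and $S_{p+1}$. The Rees quotients $S_p/S_{p+1}$ $(1\le p\le o)$ are the principal factors, with $S_o/\emptyset=S_o$. Write $\theta$ for the zero of $S$; if $S$ has no zero, then no set is contained in the $\eta^{*}$-class of $\theta$, and no element is $\eta^{*}$-related to $\theta$. Statement. Let $S_p/S_{p+1}$ be a non-null principal factor of $S$. (1) If $S_p/S_{p+1}$ is not CS-diagonal, then either $S_p\setminus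 S_{p+1}$ is contained in the $\eta^{*}$-class of $\theta$, or there is $q>p$ such that every $x\in S_p\setminus S_{p+1}$ is $\eta^{*}$-related to some $y\in S_q\setminus S_{q+1}$. (2) If some $a\in S_p\setminus S_{p+1}$ satisfies $a\,\eta^{*}\,\theta$, then $S_p\setminus S_{p+1}$ is contained in the $\eta^{*}$-class of $\theta$. (3) If every principal factor $S_q/S_{q+1}$ with $q\ge p$ is null or not CS-diagonal, then $S_p\setminus S_{p+1}$ is contained in the $\eta^{*}$-class of $\theta$. -/

import Mathlib

namespace EtaStar

universe u

/-! ### The congruence `η*` -/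

/-- The two Mal'cev sequences in a semigroup `M`: the pair `(λ_n, ρ_n)` with `λ_0 = x`, `ρ_0 = y`,
`λ_{n+1} = λ_n z_{n+1} ρ_n` and `ρ_{n+1} = ρ_n z_{n+1} λ_n`. -/
def malcev {M : Type u} [Mul M] (x y : M) (z : ℕ → M) : ℕ → M × M
  | 0 => (x, y)
  | n + 1 =>
    ((malcev x y z n).1 * z (n + 1) * (malcev x y z n).2,
      (malcev x y z n).2 * z (n + 1) * (malcev x y z n).1)

/-- The relations `η_n`, `n ≥ 1`: `η_1` is equality, and for `n > 1` we have `x η_n y` iff there are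
`z_1, …, z_n` in `S¹` with `x = λ_n(x, y, z_1, …, z_n)` and `y = ρ_n(x, y, z_1, …, z_n)`.
Here `S¹` is `WithOne S`; if `S` already has an identity, the new one acts on `S` in the same way,
so that the relation does not depend on which of the two is used. -/
def etaRel {S : Type u} [Semigroup S] (n : ℕ) (x y : S) : Prop :=
  (n = 1 ∧ x = y) ∨
    (1 < n ∧ ∃ z : ℕ → WithOne S,
      (x : WithOne S) = (malcev (x : WithOne S) (y : WithOne S) z n).1 ∧
      (y : WithOne S) = (malcev (x : WithOne S) (y : WithOne S) z n).2)

/-- `η`, the transitive closure of the union of all `η_n`, `n ≥ 1`. -/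
def eta {S : Type u} [Semigroup S] : S → S → Prop :=
  Relation.TransGen fun x y => ∃ n, 1 ≤ n ∧ etaRel n x y

/-- `η*`, the smallest congruence that contains `η`. -/
def etaStar (S : Type u) [Semigroup S] : Con S :=
  conGen eta

/-- `θ` is the zero element of `S`. -/
def IsZeroElement {S : Type u} [Semigroup S] (θ : S) : Prop :=
  ∀ s : S, s * θ = θ ∧ θ * s = θ

/-! ### Ideals, Rees quotients and principal series -/

/-- Two-sided ideals of a semigroup; the empty set counts as an ideal. -/
def IsIdeal {S : Type u} [Semigroup S] (A : Subsemigroup S) : Prop :=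
  ∀ s : S, ∀ a ∈ A, s * a ∈ A ∧ a * s ∈ A

/-- The Rees congruence on `A` of an ideal `B`: all elements of `B` are identified, and nothing
else. For `B = ∅` it is equality. -/
def reesCon {S : Type u} [Semigroup S] (A B : Subsemigroup S) (hB : IsIdeal B) : Con A where
  r x y := x = y ∨ ((x : S) ∈ B ∧ (y : S) ∈ B)
  iseqv :=
    { refl := fun _ => Or.inl rfl
      symm := by
        rintro x y (rfl | ⟨hx, hy⟩)
        · exact Or.inl rfl
        · exact Or.inr ⟨hy, hx⟩
      trans := by
        rintro x y z (rfl | ⟨hx, hy⟩) (rfl | ⟨hy', hz⟩)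
        · exact Or.inl rfl
        · exact Or.inr ⟨hy', hz⟩
        · exact Or.inr ⟨hx, hy⟩
        · exact Or.inr ⟨hx, hz⟩ }
  mul' := by
    rintro w x y z (rfl | ⟨hw, hx⟩) (rfl | ⟨hy, hz⟩)
    · exact Or.inl rfl
    · exact Or.inr ⟨(hB w y hy).1, (hB w z hz).1⟩
    · exact Or.inr ⟨(hB y w hw).2, (hB y x hx).2⟩
    · exact Or.inr ⟨(hB w y hy).1, (hB x z hz).1⟩

/-- The Rees quotient `A / B`, a semigroup; `A / ∅` is (a copy of) `A`. -/
abbrev ReesQuotient {S : Type u} [Semigroup S] (A B : Subsemigroup S) (hB : IsIdeal B) : Type u :=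
  (reesCon A B hB).Quotient

/-- A principal series `S = S_0 ⊃ S_1 ⊃ ⋯ ⊃ S_o = ∅` of `S` (numbered from `0`): each `S_p` is an
ideal, the inclusions are strict, and there is no ideal of `S` strictly between two consecutive
members. -/
structure PrincipalSeries (S : Type u) [Semigroup S] where
  /-- the number `o` of principal factors -/
  length : ℕ
  /-- the members of the series -/
  ideal : Fin (length + 1) → Subsemigroup S
  isIdeal : ∀ p, IsIdeal (ideal p)
  first_eq : ideal 0 = ⊤
  last_eq : ideal (Fin.last length) = ⊥
  strict : ∀ p : Fin length, ideal p.succ < ideal p.castSucc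
  no_between : ∀ p : Fin length, ∀ K : Subsemigroup S, IsIdeal K →
    ideal p.succ ≤ K → K ≤ ideal p.castSucc → K = ideal p.succ ∨ K = ideal p.castSucc

/-- The principal factor `S_p / S_{p+1}`. -/
abbrev PrincipalSeries.factor {S : Type u} [Semigroup S] (s : PrincipalSeries S)
    (p : Fin s.length) : Type u :=
  ReesQuotient (s.ideal p.castSucc) (s.ideal p.succ) (s.isIdeal p.succ)

/-- The set `S_p ∖ S_{p+1}`. -/
def PrincipalSeries.layer {S : Type u} [Semigroup S] (s : PrincipalSeries S)
    (p : Fin s.length) : Set S :=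
  (s.ideal p.castSucc : Set S) \ (s.ideal p.succ : Set S)

/-- A null semigroup: it has a zero, and every product is equal to that zero
(an element equal to all products is a zero). -/
def IsNull (T : Type u) [Semigroup T] : Prop :=
  ∃ z : T, ∀ x y : T, x * y = z

/-! ### Rees matrix semigroups and `CS`-diagonality -/

/-- The underlying set of the Rees matrix semigroup with zero `M⁰(G, I, Λ; P)`, where the sandwich
matrix `P` has entries in the group `G` with a zero adjoined. -/
inductive ReesMatrixZero {G I Λ : Type u} (P : Λ → I → WithZero G) : Type u
  | zero : ReesMatrixZero P
  | elem (g : G) (i : I) (j : Λ) : ReesMatrixZero P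

/-- `(g; i, j) (h; k, l)` is `(g p_{jk} h; i, l)` if `p_{jk} ≠ 0`, and the zero otherwise. -/
def ReesMatrixZero.mul {G I Λ : Type u} [Group G] {P : Λ → I → WithZero G} :
    ReesMatrixZero P → ReesMatrixZero P → ReesMatrixZero P
  | .elem g i j, .elem h k l =>
    WithZero.recZeroCoe .zero (fun p : G => .elem (g * p * h) i l) (P j k)
  | .zero, _ => .zero
  | .elem _ _ _, .zero => .zero

instance {G I Λ : Type u} [Group G] (P : Λ → I → WithZero G) :
    Semigroup (ReesMatrixZero P) where
  mul := ReesMatrixZero.mul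
  mul_assoc a b c := by
    change ReesMatrixZero.mul (ReesMatrixZero.mul a b) c =
      ReesMatrixZero.mul a (ReesMatrixZero.mul b c)
    rcases a with _ | ⟨g, i, j⟩
    · rfl
    · rcases b with _ | ⟨h, k, l⟩
      · rfl
      · rcases c with _ | ⟨f, m, n⟩
        · cases hp : P j k <;> simp [ReesMatrixZero.mul, hp]
        · cases hp : P j k <;> cases hq : P l m <;>
            simp [ReesMatrixZero.mul, hp, hq, mul_assoc]

/-- The underlying set of the Rees matrix semigroup without zero `M(G, I, Λ; P)`, where all entries
of the sandwich matrix are in the group `G`; these are the completely simple semigroups. -/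
@[ext]
structure ReesMatrix {G I Λ : Type u} (P : Λ → I → G) : Type u where
  /-- the group coordinate -/
  g : G
  /-- the row index -/
  i : I
  /-- the column index -/
  j : Λ

instance {G I Λ : Type u} [Group G] (P : Λ → I → G) : Semigroup (ReesMatrix P) where
  mul a b := ⟨a.g * P a.j b.i * b.g, a.i, b.j⟩
  mul_assoc a b c := by
    change (⟨a.g * P a.j b.i * b.g * P b.j c.i * c.g, a.i, c.j⟩ : ReesMatrix P) =
      ⟨a.g * P a.j b.i * (b.g * P b.j c.i * c.g), a.i, c.j⟩
    simp [mul_assoc]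

/-- The sandwich matrix is regular: no row and no column consists of zeros only. -/
def IsRegularMatrix {G I Λ : Type u} (P : Λ → I → WithZero G) : Prop :=
  (∀ i, ∃ j, P j i ≠ 0) ∧ ∀ j, ∃ i, P j i ≠ 0

/-- The matrix condition that defines `CS`-diagonality: if `p_{r,t}`, `p_{r',t}` and `p_{r,t'}` are
nonzero, then so is `p_{r',t'}`. -/
def IsCSMatrix {G I Λ : Type u} (P : Λ → I → WithZero G) : Prop :=
  ∀ (r r' : Λ) (t t' : I), P r t ≠ 0 → P r' t ≠ 0 → P r t' ≠ 0 → P r' t' ≠ 0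

/-- A `CS`-diagonal semigroup: one that is isomorphic to a finite regular Rees matrix semigroup
`M⁰(G, I, Λ; P)` whose sandwich matrix satisfies the condition above, or to a finite completely
simple semigroup `M(G, I, Λ; P)`, for which the condition holds because no entry is zero. -/
def IsCSDiagonal (T : Type u) [Semigroup T] : Prop :=
  (∃ (G I Λ : Type u) (_ : Group G) (_ : Finite G) (_ : Finite I) (_ : Finite Λ)
    (_ : Nonempty I) (_ : Nonempty Λ) (P : Λ → I → WithZero G),
      IsRegularMatrix P ∧ IsCSMatrix P ∧ Nonempty (T ≃* ReesMatrixZero P)) ∨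
  (∃ (G I Λ : Type u) (_ : Group G) (_ : Finite G) (_ : Finite I) (_ : Finite Λ)
    (_ : Nonempty I) (_ : Nonempty Λ) (P : Λ → I → G), Nonempty (T ≃* ReesMatrix P))

/-- The set `X` is contained in the `η*`-class of the zero `θ` of `S` (in particular `S` has a
zero). -/
def InZeroClass {S : Type u} [Semigroup S] (X : Set S) : Prop :=
  ∃ θ : S, IsZeroElement θ ∧ ∀ x ∈ X, etaStar S x θ

end EtaStar

/-! A non-null layer S_p ∖ S_{p+1} is a regular 𝒥-class of S¹. By the theorem of Rees and
Suschkewitsch (`IsJClass.exists_reesCoordinates`) it carries coordinates (g; i, j) and a sandwich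
matrix P.

If the factor is not CS-diagonal, P has p_{r,t}, p_{r',t}, p_{r,t'} nonzero and p_{r',t'} zero.
Iterating (x, y) ↦ (xy, yx) from (1; t, r), (1; t, r') keeps one element in column r and the other
in column r'. By finiteness the iteration reaches a cycle, and the members of a pair on it are
η-related. Right multiplication by (1; t', r) keeps one of them in the layer and pushes the other
into S_{p+1}. So η* links the layer to something lower (`exists_etaStar_of_not_isCSDiagonal`).

Since the elements of a layer divide each other, one link can be multiplied to start at any element
of the layer. Taking the lowest layer linked to p (`exists_lowest_layer`) gives (1). A link to θ
spreads in the same way, which is (2). For (3), squaring a link from an idempotent excludes a null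
lowest layer other than {θ}, and a regular one that is not CS-diagonal would allow a further
descent. -/

namespace EtaStar

universe u

/-! ### Regular 𝒥-classes of finite monoids and their Rees coordinates -/

/-- `J` is a `𝒥`-class of the monoid `M`: its elements divide each other, and an element between
two members of `J` in the divisibility order belongs to `J`. -/
structure IsJClass {M : Type u} [Monoid M] (J : Set M) : Prop where
  dvd : ∀ x ∈ J, ∀ y ∈ J, ∃ s t, s * y * t = x
  convex : ∀ x ∈ J, ∀ s t u v, u * (s * x * t) * v ∈ J → s * x * t ∈ J

lemma exists_pow_eq_pow_add {M : Type u} [Monoid M] [Finite M] (u : M) :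
    ∃ m k : ℕ, u ^ (m + (k + 1)) = u ^ m := by
  obtain ⟨a, b, hab, h⟩ := Finite.exists_ne_map_eq_of_infinite fun n : ℕ => u ^ n
  rcases lt_or_gt_of_ne hab with hlt | hlt
  · obtain ⟨k, rfl⟩ := Nat.exists_eq_add_of_lt hlt
    exact ⟨a, k, h.symm⟩
  · obtain ⟨k, rfl⟩ := Nat.exists_eq_add_of_lt hlt
    exact ⟨b, k, h⟩

lemma pow_mul_mul_pow_eq {M : Type u} [Monoid M] {u x w : M} (h : u * x * w = x) (n : ℕ) :
    u ^ n * x * w ^ n = x := by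
  induction n with
  | zero => simp
  | succ n ih =>
    calc u ^ (n + 1) * x * w ^ (n + 1) = u ^ n * (u * x * w) * w ^ n := by
          rw [pow_succ u, pow_succ' w]; simp only [mul_assoc]
      _ = x := by rw [h, ih]

/-- In x = uⁿ x wⁿ the exponent of u may be changed by a period of its powers while that of w stays,
so the surplus power of w fixes x. -/
lemma exists_mul_pow_eq_self {M : Type u} [Monoid M] [Finite M] {u x w : M}
    (h : u * x * w = x) : ∃ k : ℕ, x * w ^ (k + 1) = x := by
  obtain ⟨m, k, hu⟩ := exists_pow_eq_pow_add u
  refine ⟨k, ?_⟩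
  calc x * w ^ (k + 1) = u ^ m * x * w ^ m * w ^ (k + 1) := by rw [pow_mul_mul_pow_eq h]
    _ = u ^ (m + (k + 1)) * x * w ^ (m + (k + 1)) := by
      rw [hu, pow_add w m, ← mul_assoc]
    _ = x := pow_mul_mul_pow_eq h _

lemma exists_pow_mul_eq_self {M : Type u} [Monoid M] [Finite M] {u x w : M}
    (h : u * x * w = x) : ∃ k : ℕ, u ^ (k + 1) * x = x := by
  obtain ⟨m, k, hw⟩ := exists_pow_eq_pow_add w
  refine ⟨k, ?_⟩
  calc u ^ (k + 1) * x = u ^ (k + 1) * (u ^ m * x * w ^ m) := by rw [pow_mul_mul_pow_eq h]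
    _ = u ^ (m + (k + 1)) * x * w ^ (m + (k + 1)) := by
      rw [hw, add_comm m, pow_add u (k + 1)]; simp only [mul_assoc]
    _ = x := pow_mul_mul_pow_eq h _

namespace IsJClass

variable {M : Type u} [Monoid M] {J : Set M}

lemma mem_of_mul_mem (hJ : IsJClass J) {x s v : M} (hx : x ∈ J) (h : s * x * v ∈ J) :
    s * x ∈ J := by
  simpa using hJ.convex x hx s 1 1 v (by simpa using h)

lemma mem_of_mul_mem' (hJ : IsJClass J) {x t u : M} (hx : x ∈ J) (h : u * (x * t) ∈ J) :
    x * t ∈ J := by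
  simpa using hJ.convex x hx 1 t u 1 (by simpa using h)

/-- Stability of finite monoids: from x = u x (s v), some positive power of s v fixes x on the
right, so x and x s are ℛ-equivalent. -/
lemma mul_right_cancel [Finite M] (hJ : IsJClass J) {x s : M} (hx : x ∈ J) (h : x * s ∈ J) :
    ∃ t, x * s * t = x := by
  obtain ⟨u, v, huv⟩ := hJ.dvd x hx _ h
  have h' : u * x * (s * v) = x := by simpa only [mul_assoc] using huv
  obtain ⟨k, hk⟩ := exists_mul_pow_eq_self h'
  refine ⟨v * (s * v) ^ k, ?_⟩
  rw [pow_succ'] at hk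
  simpa only [mul_assoc] using hk

lemma mul_left_cancel [Finite M] (hJ : IsJClass J) {x s : M} (hx : x ∈ J) (h : s * x ∈ J) :
    ∃ t, t * (s * x) = x := by
  obtain ⟨u, v, huv⟩ := hJ.dvd x hx _ h
  have h' : (u * s) * x * v = x := by simpa only [mul_assoc] using huv
  obtain ⟨k, hk⟩ := exists_pow_mul_eq_self h'
  refine ⟨(u * s) ^ k * u, ?_⟩
  rw [pow_succ] at hk
  simpa only [mul_assoc] using hk

/-- A `𝒥`-class of a finite monoid that contains a product of two of its elements contains an
idempotent. -/
lemma exists_idempotent [Finite M] (hJ : IsJClass J) {x y : M} (hx : x ∈ J) (hy : y ∈ J)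
    (hxy : x * y ∈ J) : ∃ e ∈ J, e * e = e := by
  obtain ⟨t, ht⟩ := hJ.mul_right_cancel hx hxy
  -- The element w = y t fixes x on the right and is itself a left multiple s x, so w w = s x w = s
  -- x = w.
  have hxw : x * (y * t) = x := by rw [← mul_assoc, ht]
  have hw : y * t ∈ J := hJ.mem_of_mul_mem' hy (u := x) (by rwa [hxw])
  obtain ⟨s, hs⟩ := hJ.mul_left_cancel hw (s := x) (by rwa [hxw])
  rw [hxw] at hs
  refine ⟨y * t, hw, ?_⟩
  calc y * t * (y * t) = s * (x * (y * t)) := by rw [← mul_assoc s, hs]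
    _ = y * t := by rw [hxw, hs]

/-- The maximal subgroup at an idempotent of `J`. -/
lemma exists_maximal_subgroup [Finite M] (hJ : IsJClass J) {e : M} (he : e ∈ J)
    (hee : e * e = e) :
    ∃ (G : Type u) (_ : Group G) (_ : Finite G) (φ : G → M), Function.Injective φ ∧
      (∀ g h, φ (g * h) = φ g * φ h) ∧ ∀ x, x ∈ Set.range φ ↔ x ∈ J ∧ e * x = x ∧ x * e = x := by
  let G : Type u := {x : M // x ∈ J ∧ e * x = x ∧ x * e = x}
  have hinv (g : G) : ∃ h : G, h.1 * g.1 = e := by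
    obtain ⟨g, hg, heg, hge⟩ := g
    obtain ⟨t, ht⟩ := hJ.mul_left_cancel he (s := g) (by rwa [hge])
    rw [hge] at ht
    -- A left inverse t of g is compressed to e t e so that it lies in the local monoid at e; left
    -- inverses suffice for a group.
    have hete : e * t * e * g = e := by rw [mul_assoc (e * t), heg, mul_assoc, ht, hee]
    have hmem : e * t * e ∈ J := by
      have := hJ.convex e he 1 (t * e) 1 g (by
        rwa [one_mul, one_mul, ← mul_assoc e t e, hete])
      rwa [one_mul, ← mul_assoc] at this
    refine ⟨⟨e * t * e, hmem, ?_, ?_⟩, hete⟩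
    · simp only [← mul_assoc, hee]
    · simp only [mul_assoc, hee]
  have hmul (g h : G) : g.1 * h.1 ∈ J := by
    obtain ⟨k, hk⟩ := hinv g
    refine hJ.mem_of_mul_mem' g.2.1 (u := k.1) ?_
    rw [← mul_assoc, hk, h.2.2.1]
    exact h.2.1
  let : Mul G := ⟨fun g h => ⟨g.1 * h.1, hmul g h, by rw [← mul_assoc, g.2.2.1],
    by rw [mul_assoc, h.2.2.2]⟩⟩
  let : One G := ⟨⟨e, he, hee, hee⟩⟩
  let : Inv G := ⟨fun g => (hinv g).choose⟩
  let : Group G := Group.ofLeftAxioms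
    (fun a b c => Subtype.ext (mul_assoc a.1 b.1 c.1))
    (fun a => Subtype.ext a.2.2.1)
    (fun a => Subtype.ext (hinv a).choose_spec)
  exact ⟨G, inferInstance, inferInstance, Subtype.val, Subtype.val_injective, fun _ _ => rfl,
    fun x => ⟨fun ⟨g, hg⟩ => hg ▸ g.2, fun hx => ⟨⟨x, hx⟩, rfl⟩⟩⟩

/-- An indexed system of representatives of the `ℛ`-classes of `J`, chosen in the `ℒ`-class of the
idempotent `e`, together with left inverses of these representatives. -/
lemma exists_right_representatives [Finite M] (hJ : IsJClass J) {e : M} (he : e ∈ J)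
    (hee : e * e = e) :
    ∃ (I : Type u) (_ : Finite I) (r r' : I → M),
      (∀ i, r i ∈ J ∧ r i * e = r i ∧ r' i ∈ J ∧ e * r' i = r' i ∧ r' i * r i = e) ∧
      (∀ i k, (∃ t, r i * t = r k) → (∃ t, r k * t = r i) → i = k) ∧
      ∀ x ∈ J, ∃ i t, r i * t = x := by
  let R : Setoid J :=
    { r := fun x y => (∃ t, x.1 * t = y.1) ∧ ∃ t, y.1 * t = x.1
      iseqv :=
        { refl := fun x => ⟨⟨1, mul_one _⟩, ⟨1, mul_one _⟩⟩
          symm := fun h => ⟨h.2, h.1⟩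
          trans := by
            rintro x y z ⟨⟨a, ha⟩, ⟨b, hb⟩⟩ ⟨⟨c, hc⟩, ⟨d, hd⟩⟩
            exact ⟨⟨a * c, by rw [← mul_assoc, ha, hc]⟩, ⟨d * b, by rw [← mul_assoc, hd, hb]⟩⟩ } }
  have key (x : J) : ∃ r : J, ∃ r' : M, R.r r x ∧ r.1 * e = r.1 ∧ r' ∈ J ∧ e * r' = r' ∧
      r' * r.1 = e := by
    -- Writing x = s e t, the factor s e is ℛ-equivalent to x and ℒ-equivalent to e.
    obtain ⟨s, t, hst⟩ := hJ.dvd x.1 x.2 e he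
    have hse : s * e ∈ J := hJ.mem_of_mul_mem he (v := t) (by rw [hst]; exact x.2)
    obtain ⟨v, hv⟩ := hJ.mul_right_cancel hse (s := t) (by rw [hst]; exact x.2)
    obtain ⟨u, hu⟩ := hJ.mul_left_cancel he hse
    have heu : e * u * (s * e) = e := by rw [mul_assoc, hu, hee]
    have heuJ : e * u ∈ J := by
      have := hJ.convex e he 1 u 1 (s * e) (by rwa [one_mul, one_mul, heu])
      rwa [one_mul] at this
    exact ⟨⟨s * e, hse⟩, e * u, ⟨⟨t, hst⟩, ⟨v, by rw [← hst]; exact hv⟩⟩,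
      by rw [mul_assoc, hee], heuJ, by rw [← mul_assoc, hee], heu⟩
  choose r r' hr using key
  refine ⟨Quotient R, inferInstance, fun i => r i.out, fun i => r' i.out,
    fun i => ⟨(r i.out).2, (hr i.out).2⟩, fun i k h₁ h₂ => ?_, fun x hx => ?_⟩
  · have h : R.r i.out k.out := R.trans (R.symm (hr i.out).1) (R.trans ⟨h₁, h₂⟩ (hr k.out).1)
    simpa using Quotient.sound h
  · refine ⟨Quotient.mk R ⟨x, hx⟩, ?_⟩
    have h : R.r (Quotient.mk R ⟨x, hx⟩).out ⟨x, hx⟩ := Quotient.mk_out (s := R) _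
    exact (R.trans (hr _).1 h).1

end IsJClass

/-- `f` identifies the nonzero triples of the Rees matrix semigroup with sandwich matrix `P` with
the elements of `J`, where products that leave `J` count as zero. -/
structure IsReesCoordinates {M G I Λ : Type u} [Mul M] [Group G] (J : Set M)
    (P : Λ → I → WithZero G) (f : G → I → Λ → M) : Prop where
  regular : IsRegularMatrix P
  mem : ∀ g i j, f g i j ∈ J
  surj : ∀ x ∈ J, ∃ g i j, f g i j = x
  inj : ∀ {g i j h k l}, f g i j = f h k l → g = h ∧ i = k ∧ j = l
  mul : ∀ g i j h k l (p : G), P j k = p → f g i j * f h k l = f (g * p * h) i l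
  mul_notMem : ∀ g i j h k l, P j k = 0 → f g i j * f h k l ∉ J

namespace IsJClass

variable {M : Type u} [Monoid M] {J : Set M}

lemma op (hJ : IsJClass J) : IsJClass (MulOpposite.unop ⁻¹' J) where
  dvd x hx y hy := by
    obtain ⟨s, t, h⟩ := hJ.dvd x.unop hx y.unop hy
    exact ⟨.op t, .op s, MulOpposite.unop_injective (by simpa [mul_assoc] using h)⟩
  convex x hx s t u v h := by
    have := hJ.convex x.unop hx t.unop s.unop v.unop u.unop
      (by simpa [mul_assoc] using h)
    simpa [mul_assoc] using this

/-- The left-right dual of `exists_right_representatives`. -/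
lemma exists_left_representatives [Finite M] (hJ : IsJClass J) {e : M} (he : e ∈ J)
    (hee : e * e = e) :
    ∃ (Λ : Type u) (_ : Finite Λ) (q q' : Λ → M),
      (∀ j, q j ∈ J ∧ e * q j = q j ∧ q' j ∈ J ∧ q' j * e = q' j ∧ q j * q' j = e) ∧
      (∀ j l, (∃ t, t * q j = q l) → (∃ t, t * q l = q j) → j = l) ∧
      ∀ x ∈ J, ∃ j t, t * q j = x := by
  have : Finite Mᵐᵒᵖ := Finite.of_equiv M MulOpposite.opEquiv
  obtain ⟨Λ, hΛ, r, r', h₁, h₂, h₃⟩ :=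
    hJ.op.exists_right_representatives (e := .op e) he (by rw [← MulOpposite.op_mul, hee])
  refine ⟨Λ, hΛ, fun j => (r j).unop, fun j => (r' j).unop, fun j => ?_, fun j l => ?_,
    fun x hx => ?_⟩
  · obtain ⟨a, b, c, d, g⟩ := h₁ j
    exact ⟨a, congrArg MulOpposite.unop b, c, congrArg MulOpposite.unop d,
      congrArg MulOpposite.unop g⟩
  · rintro ⟨s, hs⟩ ⟨t, ht⟩
    exact h₂ j l ⟨.op s, MulOpposite.unop_injective hs⟩ ⟨.op t, MulOpposite.unop_injective ht⟩
  · obtain ⟨j, t, h⟩ := h₃ (.op x) hx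
    exact ⟨j, t.unop, congrArg MulOpposite.unop h⟩

/-- The theorem of Rees and Suschkewitsch for a regular `𝒥`-class of a finite monoid. -/
theorem exists_reesCoordinates [Finite M] (hJ : IsJClass J) {e : M} (he : e ∈ J)
    (hee : e * e = e) :
    ∃ (G I Λ : Type u) (_ : Group G) (_ : Finite G) (_ : Finite I) (_ : Finite Λ)
      (_ : Nonempty I) (_ : Nonempty Λ) (P : Λ → I → WithZero G) (f : G → I → Λ → M),
      IsReesCoordinates J P f := by
  obtain ⟨G, hG, hGfin, φ, φinj, φmul, hφ⟩ := hJ.exists_maximal_subgroup he hee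
  obtain ⟨I, hI, r, r', hr, rinj, rsurj⟩ := hJ.exists_right_representatives he hee
  obtain ⟨Λ, hΛ, q, q', hq, qinj, qsurj⟩ := hJ.exists_left_representatives he hee
  have φspec (g : G) : φ g ∈ J ∧ e * φ g = φ g ∧ φ g * e = φ g := (hφ _).1 ⟨g, rfl⟩
  -- The product q_j r_k is fixed by e on both sides: either it lies in the maximal subgroup, which
  -- gives the entry, or it leaves J and the entry is zero.
  have hP (j : Λ) (k : I) :
      ∃ p : WithZero G, (∀ g : G, p = g → φ g = q j * r k) ∧ (p = 0 ↔ q j * r k ∉ J) := by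
    by_cases h : q j * r k ∈ J
    · obtain ⟨g, hg⟩ := (hφ (q j * r k)).2
        ⟨h, by rw [← mul_assoc, (hq j).2.1], by rw [mul_assoc, (hr k).2.1]⟩
      exact ⟨g, fun g' h' => by rw [← WithZero.coe_inj.1 h', hg], by simp [h]⟩
    · exact ⟨0, fun g hg => absurd hg.symm WithZero.coe_ne_zero, by simp [h]⟩
  choose P hP hP0 using hP
  have cancel (g : G) (i : I) (j : Λ) : r' i * (r i * φ g * q j) * q' j = φ g := by
    calc r' i * (r i * φ g * q j) * q' j = (r' i * r i) * φ g * (q j * q' j) := by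
          simp only [mul_assoc]
      _ = φ g := by rw [(hr i).2.2.2.2, (hq j).2.2.2.2, (φspec g).2.1, (φspec g).2.2]
  have mem (g : G) (i : I) (j : Λ) : r i * φ g * q j ∈ J := by
    have h := hJ.convex (φ g) (φspec g).1 (r i) (q j) (r' i) (q' j)
    rw [cancel] at h
    exact h (φspec g).1
  have hrf (g : G) (i : I) (j : Λ) : ∃ t, r i * φ g * q j * t = r i := by
    have := hJ.mul_right_cancel (hr i).1 (s := φ g * q j) (by rw [← mul_assoc]; exact mem g i j)
    simpa only [← mul_assoc] using this
  have hqf (g : G) (i : I) (j : Λ) : ∃ t, t * (r i * φ g * q j) = q j :=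
    hJ.mul_left_cancel (hq j).1 (mem g i j)
  refine ⟨G, I, Λ, hG, hGfin, hI, hΛ, ⟨(rsurj e he).choose⟩, ⟨(qsurj e he).choose⟩, P,
    fun g i j => r i * φ g * q j, ⟨⟨fun i => ?_, fun j => ?_⟩, mem, fun x hx => ?_, ?_, ?_, ?_⟩⟩
  -- If t q_j = r'_i, then t (q_j r_i) = e lies in J, hence so does q_j r_i by convexity.
  · obtain ⟨j, t, ht⟩ := qsurj (r' i) (hr i).2.2.1
    refine ⟨j, fun h0 => (hP0 j i).1 h0 (hJ.mem_of_mul_mem' (hq j).1 (u := t) ?_)⟩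
    rw [← mul_assoc, ht, (hr i).2.2.2.2]
    exact he
  · obtain ⟨i, t, ht⟩ := rsurj (q' j) (hq j).2.2.1
    refine ⟨i, fun h0 => (hP0 j i).1 h0 (hJ.mem_of_mul_mem (hr i).1 (v := t) ?_)⟩
    rw [mul_assoc, ht, (hq j).2.2.2.2]
    exact he
  · obtain ⟨i, t, ht⟩ := rsurj x hx
    obtain ⟨j, s, hs⟩ := qsurj x hx
    have h₁ : r i * (r' i * x) = x := by
      rw [← ht, ← mul_assoc (r' i), (hr i).2.2.2.2, ← mul_assoc, (hr i).2.1]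
    have h₂ : x * q' j * q j = x := by
      rw [← hs, mul_assoc s, (hq j).2.2.2.2, mul_assoc, (hq j).2.1]
    have h₃ : r i * (r' i * x * q' j) * q j = x := by
      rw [← mul_assoc, h₁, h₂]
    obtain ⟨g, hg⟩ := (hφ (r' i * x * q' j)).2
      ⟨hJ.convex x hx _ _ (r i) (q j) (by rwa [h₃]),
        by simp only [← mul_assoc, (hr i).2.2.2.1], by simp only [mul_assoc, (hq j).2.2.2.1]⟩
    exact ⟨g, i, j, by simp only [hg, h₃]⟩
  · intro g i j h k l heq
    obtain rfl : i = k := by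
      refine rinj i k ?_ ?_
      · obtain ⟨t, ht⟩ := hrf h k l
        exact ⟨φ g * q j * t, by rw [← ht, ← heq]; simp only [mul_assoc]⟩
      · obtain ⟨t, ht⟩ := hrf g i j
        exact ⟨φ h * q l * t, by rw [← ht, heq]; simp only [mul_assoc]⟩
    obtain rfl : j = l := by
      refine qinj j l ?_ ?_
      · obtain ⟨t, ht⟩ := hqf h i l
        exact ⟨t * (r i * φ g), by rw [← ht, ← heq]; simp only [mul_assoc]⟩
      · obtain ⟨t, ht⟩ := hqf g i j
        exact ⟨t * (r i * φ h), by rw [← ht, heq]; simp only [mul_assoc]⟩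
    exact ⟨φinj (by rw [← cancel g i j, heq, cancel]), rfl, rfl⟩
  · intro g i j h k l p hp
    simp only [φmul, hP j k p hp, mul_assoc]
  · intro g i j h k l hp hmem
    refine (hP0 j k).1 hp ?_
    have h₁ : r i * φ g * (q j * r k) * (φ h * q l) ∈ J := by
      simpa only [mul_assoc] using hmem
    exact one_mul (q j) ▸ hJ.convex (q j) (hq j).1 1 (r k) (r i * φ g) (φ h * q l)
      (by rwa [one_mul])

end IsJClass

/-! ### Mal'cev sequences in a finite semigroup -/

variable {S : Type u} [Semigroup S]

/-- With trivial multipliers the Mal'cev sequence is the orbit of a self-map of the finite set S ×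
S, hence eventually periodic. -/
lemma malcev_one_eq_iterate (x y : S) (n : ℕ) :
    malcev (x : WithOne S) (y : WithOne S) (fun _ => 1) n =
      Prod.map (↑) (↑) ((fun w : S × S => (w.1 * w.2, w.2 * w.1))^[n] (x, y)) := by
  induction n with
  | zero => rfl
  | succ n ih =>
    rw [Function.iterate_succ_apply', malcev, ih]
    simp

/-- Finiteness forces the Mal'cev sequences with all `z_n = 1` to run into a cycle, whose members
are `η`-related. -/
lemma exists_eta_iterate [Finite S] (x y : S) :
    ∃ k, eta ((fun w : S × S => (w.1 * w.2, w.2 * w.1))^[k] (x, y)).1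
      ((fun w : S × S => (w.1 * w.2, w.2 * w.1))^[k] (x, y)).2 := by
  set F : S × S → S × S := fun w => (w.1 * w.2, w.2 * w.1) with hF
  have hper : ∃ k d, F^[d + 1] (F^[k] (x, y)) = F^[k] (x, y) := by
    obtain ⟨a, b, hab, h⟩ := Finite.exists_ne_map_eq_of_infinite fun n : ℕ => F^[n] (x, y)
    rcases lt_or_gt_of_ne hab with hlt | hlt
    · obtain ⟨d, rfl⟩ := Nat.exists_eq_add_of_lt hlt
      exact ⟨a, d, by rw [← Function.iterate_add_apply, add_comm, ← add_assoc]; exact h.symm⟩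
    · obtain ⟨d, rfl⟩ := Nat.exists_eq_add_of_lt hlt
      exact ⟨b, d, by rw [← Function.iterate_add_apply, add_comm, ← add_assoc]; exact h⟩
  obtain ⟨k, d, hd⟩ := hper
  -- The period d + 1 may be 1, whereas the Mal'cev clause needs n > 1; going round the cycle twice
  -- is always enough.
  refine ⟨k, Relation.TransGen.single ⟨(d + 1) + (d + 1), by omega, Or.inr
    ⟨by omega, fun _ => 1, ?_⟩⟩⟩
  rw [malcev_one_eq_iterate, Prod.mk.eta, ← hF, Function.iterate_add_apply, hd, hd]
  exact ⟨rfl, rfl⟩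

/-- If the sandwich matrix violates the `CS` condition, then some element of `J` is `η`-related
to another one that a suitable right multiplication separates from it. -/
lemma IsReesCoordinates.exists_eta_of_not_isCSMatrix [Finite S] {G I Λ : Type u} [Group G]
    {J : Set S} {P : Λ → I → WithZero G} {f : G → I → Λ → S} (hf : IsReesCoordinates J P f)
    (hP : ¬ IsCSMatrix P) :
    ∃ u ∈ J, ∃ v ∈ J, ∃ c, eta u v ∧ ((u * c ∈ J ∧ v * c ∉ J) ∨ (v * c ∈ J ∧ u * c ∉ J)) := by
  simp only [IsCSMatrix, not_forall, not_not] at hP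
  obtain ⟨r, r', t, t', h₁, h₂, h₃, h₄⟩ := hP
  obtain ⟨a, ha⟩ := WithZero.ne_zero_iff_exists.1 h₁
  obtain ⟨b, hb⟩ := WithZero.ne_zero_iff_exists.1 h₂
  obtain ⟨c, hc⟩ := WithZero.ne_zero_iff_exists.1 h₃
  -- Both elements keep the index t, and each step exchanges the indices r and r'.
  have inv (n : ℕ) : ∃ g h,
      (fun w : S × S => (w.1 * w.2, w.2 * w.1))^[n] (f 1 t r, f 1 t r') = (f g t r, f h t r') ∨
      (fun w : S × S => (w.1 * w.2, w.2 * w.1))^[n] (f 1 t r, f 1 t r') =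
        (f h t r', f g t r) := by
    induction n with
    | zero => exact ⟨1, 1, Or.inl rfl⟩
    | succ n ih =>
      obtain ⟨g, h, ih⟩ := ih
      refine ⟨h * b * g, g * a * h, ?_⟩
      rw [Function.iterate_succ_apply']
      rcases ih with ih | ih
      · right
        rw [ih, hf.mul g t r h t r' a ha.symm, hf.mul h t r' g t r b hb.symm]
      · left
        rw [ih, hf.mul g t r h t r' a ha.symm, hf.mul h t r' g t r b hb.symm]
  have hin (g : G) : f g t r * f 1 t' r ∈ J := by
    rw [hf.mul g t r 1 t' r c hc.symm]
    exact hf.mem _ _ _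
  have hout (g : G) : f g t r' * f 1 t' r ∉ J := hf.mul_notMem g t r' 1 t' r h₄
  obtain ⟨k, hk⟩ := exists_eta_iterate (f 1 t r) (f 1 t r')
  obtain ⟨g, h, hgh | hgh⟩ := inv k
  · rw [hgh] at hk
    exact ⟨_, hf.mem _ _ _, _, hf.mem _ _ _, _, hk, Or.inl ⟨hin g, hout h⟩⟩
  · rw [hgh] at hk
    exact ⟨_, hf.mem _ _ _, _, hf.mem _ _ _, _, hk, Or.inr ⟨hin g, hout h⟩⟩

/-- Divisibility in a layer is witnessed by multipliers in S¹, while congruences live on S; this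
carries related pairs across. -/
lemma con_of_coe_eq (c : Con S) {u v x y : S} (h : c u v) {s t : WithOne S}
    (hx : s * u * t = (x : WithOne S)) (hy : s * v * t = (y : WithOne S)) : c x y := by
  have key (s t : WithOne S) : ∃ x' y' : S, s * u * t = (x' : WithOne S) ∧
      s * v * t = (y' : WithOne S) ∧ c x' y' := by
    cases s <;> cases t
    · exact ⟨u, v, by simp, by simp, h⟩
    · rename_i t
      exact ⟨u * t, v * t, by simp, by simp, c.mul h (c.refl t)⟩
    · rename_i s
      exact ⟨s * u, s * v, by simp, by simp, c.mul (c.refl s) h⟩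
    · rename_i s t
      exact ⟨s * u * t, s * v * t, by simp, by simp, c.mul (c.mul (c.refl s) h) (c.refl t)⟩
  obtain ⟨x', y', h₁, h₂, h₃⟩ := key s t
  obtain rfl : x' = x := WithOne.coe_injective (h₁ ▸ hx)
  obtain rfl : y' = y := WithOne.coe_injective (h₂ ▸ hy)
  exact h₃

lemma IsIdeal.exists_coe_eq {A : Subsemigroup S} (hA : IsIdeal A) {a : S} (ha : a ∈ A)
    (s t : WithOne S) : ∃ b ∈ A, (b : WithOne S) = s * a * t := by
  cases s <;> cases t
  · exact ⟨a, ha, by simp⟩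
  · rename_i t
    exact ⟨a * t, (hA t a ha).2, by simp⟩
  · rename_i s
    exact ⟨s * a, (hA s a ha).1, by simp⟩
  · rename_i s t
    exact ⟨s * a * t, (hA t _ (hA s a ha).1).2, by simp⟩

lemma IsIdeal.mem_of_coe_eq {A : Subsemigroup S} (hA : IsIdeal A) {a b : S} (ha : a ∈ A)
    {s t : WithOne S} (h : s * a * t = (b : WithOne S)) : b ∈ A := by
  obtain ⟨b', hb', h'⟩ := hA.exists_coe_eq ha s t
  rwa [← WithOne.coe_injective (h'.trans h)]

/-! ### Layers of a principal series as 𝒥-classes -/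

namespace PrincipalSeries

variable (s : PrincipalSeries S) (p : Fin s.length)

/-- S_{p+1} ∪ S¹yS¹ is an ideal inside S_p that properly contains S_{p+1}, so it is all of S_p. -/
lemma exists_mul_mul_eq {x y : S} (hx : x ∈ s.layer p) (hy : y ∈ s.layer p) :
    ∃ a b : WithOne S, a * y * b = (x : WithOne S) := by
  let K : Subsemigroup S :=
    { carrier := {z | z ∈ s.ideal p.succ ∨ ∃ a b : WithOne S, a * y * b = (z : WithOne S)}
      mul_mem' := by
        rintro z w (hz | ⟨a, b, hz⟩) -
        · exact Or.inl (s.isIdeal _ w z hz).2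
        · exact Or.inr ⟨a, b * w, by rw [← mul_assoc, hz, WithOne.coe_mul]⟩ }
  have hK : IsIdeal K := by
    rintro w z (hz | ⟨a, b, hz⟩)
    · exact ⟨Or.inl (s.isIdeal _ w z hz).1, Or.inl (s.isIdeal _ w z hz).2⟩
    · exact ⟨Or.inr ⟨w * a, b, by rw [WithOne.coe_mul, ← hz]; simp only [mul_assoc]⟩,
        Or.inr ⟨a, b * w, by rw [← mul_assoc, hz, WithOne.coe_mul]⟩⟩
  have hle : K ≤ s.ideal p.castSucc := by
    rintro z (hz | ⟨a, b, hz⟩)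
    · exact (s.strict p).le hz
    · exact (s.isIdeal _).mem_of_coe_eq hy.1 hz
  have hyK : y ∈ K := Or.inr ⟨1, 1, by simp⟩
  rcases s.no_between p K hK (fun z hz => Or.inl hz) hle with h | h
  · exact absurd (h ▸ hyK) hy.2
  · have hxK : x ∈ K := h ▸ hx.1
    exact hxK.resolve_left hx.2

lemma isJClass_layer : IsJClass ((↑) '' s.layer p : Set (WithOne S)) where
  dvd := by
    rintro _ ⟨x, hx, rfl⟩ _ ⟨y, hy, rfl⟩
    exact s.exists_mul_mul_eq p hx hy
  convex := by
    rintro _ ⟨x, hx, rfl⟩ a t u v ⟨w, hw, hwe⟩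
    obtain ⟨z, hz, hze⟩ := (s.isIdeal p.castSucc).exists_coe_eq hx.1 a t
    rw [← hze] at hwe ⊢
    exact ⟨z, ⟨hz, fun hz' => hw.2 ((s.isIdeal _).mem_of_coe_eq hz' hwe.symm)⟩, rfl⟩

lemma exists_mul_mem_layer (hp : ¬ IsNull (s.factor p)) :
    ∃ x ∈ s.layer p, ∃ y ∈ s.layer p, x * y ∈ s.layer p := by
  by_contra! h
  refine hp ?_
  by_cases hB : ∃ b, b ∈ s.ideal p.succ
  · obtain ⟨b, hb⟩ := hB
    refine ⟨((⟨b, (s.strict p).le hb⟩ : s.ideal p.castSucc) :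
      (reesCon (s.ideal p.castSucc) (s.ideal p.succ) (s.isIdeal p.succ)).Quotient), ?_⟩
    intro x y
    induction x, y using Con.induction_on₂ with
    | H x y =>
      rw [← Con.coe_mul, Con.eq]
      refine Or.inr ⟨?_, hb⟩
      by_cases hx : (x : S) ∈ s.ideal p.succ
      · exact (s.isIdeal _ _ _ hx).2
      by_cases hy : (y : S) ∈ s.ideal p.succ
      · exact (s.isIdeal _ _ _ hy).1
      by_contra hxy
      exact h x ⟨x.2, hx⟩ y ⟨y.2, hy⟩ ⟨(x * y).2, hxy⟩
  -- If S_{p+1} is empty, the layer is the ideal S_p itself and is closed under products.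
  · push Not at hB
    obtain ⟨a, ha, ha'⟩ := SetLike.exists_of_lt (s.strict p)
    exact absurd ⟨mul_mem ha ha, hB _⟩ (h a ⟨ha, ha'⟩ a ⟨ha, ha'⟩)

lemma exists_idempotent_mem_layer [Finite S] (hp : ¬ IsNull (s.factor p)) :
    ∃ e ∈ s.layer p, e * e = e := by
  have : Finite (WithOne S) := inferInstanceAs (Finite (Option S))
  obtain ⟨x, hx, y, hy, hxy⟩ := s.exists_mul_mem_layer p hp
  obtain ⟨_, ⟨e, he, rfl⟩, hee⟩ := (s.isJClass_layer p).exists_idempotent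
    ⟨x, hx, rfl⟩ ⟨y, hy, rfl⟩ ⟨x * y, hxy, WithOne.coe_mul x y⟩
  exact ⟨e, he, WithOne.coe_injective (by rw [WithOne.coe_mul, hee])⟩

lemma exists_reesCoordinates [Finite S] (hp : ¬ IsNull (s.factor p)) :
    ∃ (G I Λ : Type u) (_ : Group G) (_ : Finite G) (_ : Finite I) (_ : Finite Λ)
      (_ : Nonempty I) (_ : Nonempty Λ) (P : Λ → I → WithZero G) (f : G → I → Λ → S),
      IsReesCoordinates (s.layer p) P f := by
  have : Finite (WithOne S) := inferInstanceAs (Finite (Option S))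
  obtain ⟨e, he, hee⟩ := s.exists_idempotent_mem_layer p hp
  obtain ⟨G, I, Λ, i₁, i₂, i₃, i₄, i₅, i₆, P, f, hf⟩ :=
    (s.isJClass_layer p).exists_reesCoordinates ⟨e, he, rfl⟩
      (by rw [← WithOne.coe_mul, hee])
  choose f' hmem hf' using hf.mem
  refine ⟨G, I, Λ, i₁, i₂, i₃, i₄, i₅, i₆, P, f', hf.regular, hmem, fun x hx => ?_, ?_, ?_, ?_⟩
  · obtain ⟨g, i, j, h⟩ := hf.surj x ⟨x, hx, rfl⟩
    exact ⟨g, i, j, WithOne.coe_injective ((hf' _ _ _).trans h)⟩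
  · intro g i j h k l heq
    exact hf.inj (by rw [← hf', heq, hf'])
  · intro g i j h k l p hp
    exact WithOne.coe_injective (by rw [WithOne.coe_mul, hf', hf', hf', hf.mul _ _ _ _ _ _ p hp])
  · intro g i j h k l hp hmem
    exact hf.mul_notMem g i j h k l hp ⟨_, hmem, by rw [WithOne.coe_mul, hf', hf']⟩

end PrincipalSeries

lemma IsZeroElement.mul_coe_mul {θ : S} (hθ : IsZeroElement θ) (a b : WithOne S) :
    a * θ * b = (θ : WithOne S) := by
  cases a <;> cases b <;> simp [← WithOne.coe_mul, (hθ _).1, (hθ _).2]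

/-! ### Principal factors as Rees matrix semigroups -/

namespace PrincipalSeries

variable (s : PrincipalSeries S) (p : Fin s.length)

/-- The class in `S_p / S_{p+1}` of an element of `S_p`. -/
def toFactor (x : S) (hx : x ∈ s.ideal p.castSucc) : s.factor p :=
  ((⟨x, hx⟩ : s.ideal p.castSucc) :
    (reesCon (s.ideal p.castSucc) (s.ideal p.succ) (s.isIdeal p.succ)).Quotient)

lemma toFactor_eq_iff {x y : S} (hx : x ∈ s.ideal p.castSucc) (hy : y ∈ s.ideal p.castSucc) :
    s.toFactor p x hx = s.toFactor p y hy ↔ x = y ∨ (x ∈ s.ideal p.succ ∧ y ∈ s.ideal p.succ) := by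
  rw [toFactor, toFactor, Con.eq]
  exact or_congr_left Subtype.mk_eq_mk

lemma toFactor_mul {x y : S} (hx : x ∈ s.ideal p.castSucc) (hy : y ∈ s.ideal p.castSucc) :
    s.toFactor p x hx * s.toFactor p y hy = s.toFactor p (x * y) (mul_mem hx hy) := rfl

lemma exists_toFactor_eq (z : s.factor p) : ∃ x hx, s.toFactor p x hx = z := by
  induction z using Con.induction_on with
  | H x => exact ⟨x, x.2, rfl⟩

/-- The element b shows that S_{p+1} is nonempty; its class is the image of the matrix zero. -/
lemma isCSDiagonal_factor_of_mem {G I Λ : Type u} [Group G] [Finite G] [Finite I] [Finite Λ]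
    [Nonempty I] [Nonempty Λ] {P : Λ → I → WithZero G} {f : G → I → Λ → S}
    (hf : IsReesCoordinates (s.layer p) P f) (hP : IsCSMatrix P) {b : S}
    (hb : b ∈ s.ideal p.succ) : IsCSDiagonal (s.factor p) := by
  have hb' := (s.strict p).le hb
  let F : ReesMatrixZero P → s.factor p := fun a => match a with
    | .zero => s.toFactor p b hb'
    | .elem g i j => s.toFactor p (f g i j) (hf.mem g i j).1
  have hF : Function.Bijective F := by
    constructor
    · rintro (_ | ⟨g, i, j⟩) (_ | ⟨h, k, l⟩) heq
      · rfl
      · rcases (s.toFactor_eq_iff p _ _).1 heq with h' | h'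
        · exact absurd (h' ▸ hb) (hf.mem h k l).2
        · exact absurd h'.2 (hf.mem h k l).2
      · rcases (s.toFactor_eq_iff p _ _).1 heq with h' | h'
        · exact absurd (h' ▸ hb) (hf.mem g i j).2
        · exact absurd h'.1 (hf.mem g i j).2
      · rcases (s.toFactor_eq_iff p _ _).1 heq with h' | h'
        · obtain ⟨rfl, rfl, rfl⟩ := hf.inj h'
          rfl
        · exact absurd h'.1 (hf.mem g i j).2
    · intro z
      obtain ⟨x, hx, rfl⟩ := s.exists_toFactor_eq p z
      by_cases hx' : x ∈ s.ideal p.succ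
      · exact ⟨.zero, (s.toFactor_eq_iff p _ _).2 (Or.inr ⟨hb, hx'⟩)⟩
      · obtain ⟨g, i, j, rfl⟩ := hf.surj x ⟨hx, hx'⟩
        exact ⟨.elem g i j, rfl⟩
  have hmul (x y : ReesMatrixZero P) : F (x * y) = F x * F y := by
    rcases x with _ | ⟨g, i, j⟩
    · have hz : (ReesMatrixZero.zero : ReesMatrixZero P) * y = .zero := rfl
      rw [hz]
      obtain ⟨w, hw, h⟩ := s.exists_toFactor_eq p (F y)
      rw [← h]
      exact (s.toFactor_eq_iff p _ _).2 (Or.inr ⟨hb, (s.isIdeal _ _ _ hb).2⟩)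
    · rcases y with _ | ⟨h, k, l⟩
      · exact (s.toFactor_eq_iff p hb' (mul_mem (hf.mem g i j).1 hb')).2
          (Or.inr ⟨hb, (s.isIdeal _ _ _ hb).1⟩)
      · change F (ReesMatrixZero.mul _ _) =
          s.toFactor p (f g i j * f h k l) (mul_mem (hf.mem _ _ _).1 (hf.mem _ _ _).1)
        cases hp : P j k with
        | zero =>
          simp only [ReesMatrixZero.mul, hp, WithZero.recZeroCoe_zero]
          refine (s.toFactor_eq_iff p _ _).2 (Or.inr ⟨hb, ?_⟩)
          by_contra hn
          exact hf.mul_notMem g i j h k l hp ⟨mul_mem (hf.mem _ _ _).1 (hf.mem _ _ _).1, hn⟩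
        | coe c =>
          simp only [ReesMatrixZero.mul, hp, WithZero.recZeroCoe_coe]
          exact (s.toFactor_eq_iff p _ _).2 (Or.inl (hf.mul g i j h k l c hp).symm)
  exact Or.inl ⟨G, I, Λ, inferInstance, inferInstance, inferInstance, inferInstance,
    inferInstance, inferInstance, P, hf.regular, hP,
    ⟨(MulEquiv.ofBijective (⟨F, hmul⟩ : ReesMatrixZero P →ₙ* s.factor p) hF).symm⟩⟩

/-- With S_{p+1} empty no product leaves the layer, so no entry of P vanishes and the factor is
completely simple. -/
lemma isCSDiagonal_factor_of_forall_notMem {G I Λ : Type u} [Group G] [Finite G] [Finite I]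
    [Finite Λ] [Nonempty I] [Nonempty Λ] {P : Λ → I → WithZero G} {f : G → I → Λ → S}
    (hf : IsReesCoordinates (s.layer p) P f) (hB : ∀ b, b ∉ s.ideal p.succ) :
    IsCSDiagonal (s.factor p) := by
  have hP (j : Λ) (i : I) : ∃ c : G, P j i = c := by
    cases hp : P j i with
    | zero =>
      exact absurd ⟨mul_mem (hf.mem _ _ _).1 (hf.mem _ _ _).1, hB _⟩
        (hf.mul_notMem 1 i j 1 i j hp)
    | coe c => exact ⟨c, rfl⟩
  choose Q hQ using hP
  let F : ReesMatrix Q → s.factor p := fun a => s.toFactor p (f a.g a.i a.j) (hf.mem _ _ _).1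
  have hF : Function.Bijective F := by
    constructor
    · intro x y heq
      obtain ⟨h₁, h₂, h₃⟩ :=
        hf.inj (((s.toFactor_eq_iff p _ _).1 heq).resolve_right fun h => hB _ h.1)
      exact ReesMatrix.ext h₁ h₂ h₃
    · intro z
      obtain ⟨x, hx, rfl⟩ := s.exists_toFactor_eq p z
      obtain ⟨g, i, j, rfl⟩ := hf.surj x ⟨hx, hB x⟩
      exact ⟨⟨g, i, j⟩, rfl⟩
  have hmul (x y : ReesMatrix Q) : F (x * y) = F x * F y :=
    (s.toFactor_eq_iff p _ (mul_mem (hf.mem _ _ _).1 (hf.mem _ _ _).1)).2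
      (Or.inl (hf.mul x.g x.i x.j y.g y.i y.j _ (hQ _ _)).symm)
  exact Or.inr ⟨G, I, Λ, inferInstance, inferInstance, inferInstance, inferInstance,
    inferInstance, inferInstance, Q,
    ⟨(MulEquiv.ofBijective (⟨F, hmul⟩ : ReesMatrix Q →ₙ* s.factor p) hF).symm⟩⟩

/-- If a regular principal factor is not `CS`-diagonal, then `η*` relates some element of its layer
to an element further down. -/
lemma exists_etaStar_of_not_isCSDiagonal [Finite S] (hp : ¬ IsNull (s.factor p))
    (hcs : ¬ IsCSDiagonal (s.factor p)) :
    ∃ u ∈ s.layer p, ∃ v ∈ s.ideal p.succ, etaStar S u v := by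
  obtain ⟨G, I, Λ, _, _, _, _, _, _, P, f, hf⟩ := s.exists_reesCoordinates p hp
  have hP : ¬ IsCSMatrix P := fun hP => hcs <| by
    by_cases hB : ∃ b, b ∈ s.ideal p.succ
    · obtain ⟨b, hb⟩ := hB
      exact s.isCSDiagonal_factor_of_mem p hf hP hb
    · exact s.isCSDiagonal_factor_of_forall_notMem p hf (by simpa using hB)
  obtain ⟨u, hu, v, hv, c, huv, h⟩ := hf.exists_eta_of_not_isCSMatrix hP
  have hc : etaStar S (u * c) (v * c) :=
    (etaStar S).mul (ConGen.Rel.of _ _ huv) ((etaStar S).refl c)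
  have hmem {w : S} (hw : w ∈ s.layer p) (h : w * c ∉ s.layer p) : w * c ∈ s.ideal p.succ := by
    by_contra hn
    exact h ⟨(s.isIdeal _ c w hw.1).2, hn⟩
  rcases h with ⟨h₁, h₂⟩ | ⟨h₁, h₂⟩
  · exact ⟨_, h₁, _, hmem hv h₂, hc⟩
  · exact ⟨_, h₁, _, hmem hu h₂, (etaStar S).symm hc⟩

/-! ### Descent along η* to the lowest linked layer -/

lemma exists_mem_layer_of_mem_ideal {k : Fin (s.length + 1)} {x : S} (hx : x ∈ s.ideal k) :
    ∃ q : Fin s.length, k ≤ q.castSucc ∧ x ∈ s.layer q := by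
  induction k using Fin.reverseInduction with
  | last =>
    rw [s.last_eq] at hx
    exact absurd hx Subsemigroup.notMem_bot
  | cast k ih =>
    by_cases hx' : x ∈ s.ideal k.succ
    · obtain ⟨q, hq, hxq⟩ := ih hx'
      exact ⟨q, k.castSucc_lt_succ.le.trans hq, hxq⟩
    · exact ⟨k, le_rfl, hx, hx'⟩

/-- If `η*` relates some element of the layer of `p` to an element of the layer of `q`, but never
one to an element further down, then it relates every element of the layer of `p` to an element of
the layer of `q`. -/
lemma forall_exists_etaStar {q : Fin s.length} {u v : S} (hu : u ∈ s.layer p) (hv : v ∈ s.layer q)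
    (huv : etaStar S u v) (hmax : ∀ x ∈ s.layer p, ∀ y ∈ s.ideal q.succ, ¬ etaStar S x y) :
    ∀ x ∈ s.layer p, ∃ y ∈ s.layer q, etaStar S x y := by
  intro x hx
  obtain ⟨a, b, hab⟩ := s.exists_mul_mul_eq p hx hu
  obtain ⟨y, hy, hye⟩ := (s.isIdeal q.castSucc).exists_coe_eq hv.1 a b
  have hxy := con_of_coe_eq _ huv hab hye.symm
  exact ⟨y, ⟨hy, fun hy' => hmax x hx y hy' hxy⟩, hxy⟩

/-- There is a lowest layer that `η*` links to the layer of `p`. -/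
lemma exists_lowest_layer {u v : S} {k : Fin (s.length + 1)} (hu : u ∈ s.layer p)
    (hv : v ∈ s.ideal k) (huv : etaStar S u v) :
    ∃ q : Fin s.length, k ≤ q.castSucc ∧ (∀ x ∈ s.layer p, ∃ y ∈ s.layer q, etaStar S x y) ∧
      ∀ x ∈ s.layer p, ∀ y ∈ s.ideal q.succ, ¬ etaStar S x y := by
  obtain ⟨q₀, hq₀, hvq₀⟩ := s.exists_mem_layer_of_mem_ideal hv
  let T : Set (Fin s.length) := {q | k ≤ q.castSucc ∧ ∃ x ∈ s.layer p, ∃ y ∈ s.layer q,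
    etaStar S x y}
  -- Indices grow downwards, so a maximal index is a lowest layer.
  obtain ⟨q, hq⟩ := (Set.toFinite T).exists_maximal ⟨q₀, hq₀, u, hu, v, hvq₀, huv⟩
  obtain ⟨⟨hkq, x, hx, y, hy, hxy⟩, hmax⟩ := hq
  have hlow : ∀ x ∈ s.layer p, ∀ y ∈ s.ideal q.succ, ¬ etaStar S x y := by
    intro x hx y hy hxy
    obtain ⟨r, hr, hyr⟩ := s.exists_mem_layer_of_mem_ideal hy
    have hqr : q.castSucc < r.castSucc := q.castSucc_lt_succ.trans_le hr
    have := hmax (y := r) ⟨hkq.trans hqr.le, x, hx, y, hyr, hxy⟩ (le_of_lt hqr)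
    exact absurd hqr (not_lt.2 this)
  exact ⟨q, hkq, s.forall_exists_etaStar p hx hy hxy hlow, hlow⟩

lemma mul_mem_of_isNull {q : Fin s.length} (hq : IsNull (s.factor q)) {x y x' y' : S}
    (hx : x ∈ s.ideal q.castSucc) (hy : y ∈ s.ideal q.castSucc) (hx' : x' ∈ s.ideal q.castSucc)
    (hy' : y' ∈ s.ideal q.castSucc) :
    x * y = x' * y' ∨ (x * y ∈ s.ideal q.succ ∧ x' * y' ∈ s.ideal q.succ) := by
  obtain ⟨z, hz⟩ := hq
  rw [← s.toFactor_eq_iff q (mul_mem hx hy) (mul_mem hx' hy'), ← s.toFactor_mul q hx hy,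
    ← s.toFactor_mul q hx' hy', hz, hz]

/-- In a null factor whose lower ideal is nonempty all products fall into that ideal. -/
lemma mul_mem_succ_of_isNull {q : Fin s.length} (hq : IsNull (s.factor q)) {b x y : S}
    (hb : b ∈ s.ideal q.succ) (hx : x ∈ s.ideal q.castSucc) (hy : y ∈ s.ideal q.castSucc) :
    x * y ∈ s.ideal q.succ := by
  have hb' := (s.strict q).le hb
  rcases s.mul_mem_of_isNull hq hx hy hb' hb' with h | h
  · rw [h]
    exact mul_mem hb hb
  · exact h.1

/-- If the minimal ideal is null, then it consists of the zero of `S`. -/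
lemma isZeroElement_of_isNull {q : Fin s.length} (hq : IsNull (s.factor q))
    (hB : ∀ b, b ∉ s.ideal q.succ) {x : S} (hx : x ∈ s.layer q) : IsZeroElement x := by
  have hmul {a b c d : S} (ha : a ∈ s.ideal q.castSucc) (hb : b ∈ s.ideal q.castSucc)
      (hc : c ∈ s.ideal q.castSucc) (hd : d ∈ s.ideal q.castSucc) : a * b = c * d :=
    (s.mul_mem_of_isNull hq ha hb hc hd).resolve_right fun h => hB _ h.1
  have hz : IsZeroElement (x * x) := by
    intro t
    have h₁ := (s.isIdeal _ t x hx.1).1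
    have h₂ := (s.isIdeal _ t x hx.1).2
    exact ⟨by rw [← mul_assoc]; exact hmul h₁ hx.1 hx.1 hx.1,
      by rw [mul_assoc]; exact hmul hx.1 h₂ hx.1 hx.1⟩
  -- The square x x is a zero and divides x, and all multiples of a zero equal it; hence x = x x.
  obtain ⟨a, b, hab⟩ :=
    s.exists_mul_mul_eq q hx ⟨mul_mem hx.1 hx.1, hB _⟩
  rwa [← WithOne.coe_injective ((hz.mul_coe_mul a b).symm.trans hab)]

/-- If no principal factor from `p` on is regular and `CS`-diagonal, then the layer of `p` is
`η*`-related to the zero. -/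
lemma inZeroClass_layer [Finite S] (hp : ¬ IsNull (s.factor p))
    (hall : ∀ q : Fin s.length, p ≤ q → IsNull (s.factor q) ∨ ¬ IsCSDiagonal (s.factor q)) :
    InZeroClass (s.layer p) := by
  obtain ⟨e, he, hee⟩ := s.exists_idempotent_mem_layer p hp
  -- The trivial link from e to itself starts the search, so q = p is allowed.
  obtain ⟨q, hpq, hq, hlow⟩ := s.exists_lowest_layer p he he.1 ((etaStar S).refl e)
  obtain ⟨y, hy, hey⟩ := hq e he
  by_cases hnull : IsNull (s.factor q)
  · by_cases hB : ∃ b, b ∈ s.ideal q.succ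
    · obtain ⟨b, hb⟩ := hB
      -- Squaring the link fixes the idempotent e but drops y into the next ideal.
      have h := (etaStar S).mul hey hey
      rw [hee] at h
      exact absurd h (hlow e he _ (s.mul_mem_succ_of_isNull hnull hb hy.1 hy.1))
    · push Not at hB
      have hzero {y : S} (hy : y ∈ s.layer q) : IsZeroElement y :=
        s.isZeroElement_of_isNull hnull hB hy
      refine ⟨y, hzero hy, fun x hx => ?_⟩
      obtain ⟨z, hz, hxz⟩ := hq x hx
      rwa [← (hzero hy z).1, (hzero hz y).2]
  · obtain ⟨u, hu, v, hv, huv⟩ := s.exists_etaStar_of_not_isCSDiagonal q hnull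
      ((hall q hpq).resolve_left hnull)
    -- The descending pair (u, v) is multiplied so that it starts at y; composed with e η* y it
    -- links e below q.
    obtain ⟨a, b, hab⟩ := s.exists_mul_mul_eq q hy hu
    obtain ⟨w, hw, hwe⟩ := (s.isIdeal q.succ).exists_coe_eq hv a b
    exact absurd ((etaStar S).trans hey (con_of_coe_eq _ huv hab hwe.symm)) (hlow e he w hw)

lemma etaStar_zero_of_mem_layer {θ a : S} (hθ : IsZeroElement θ) (ha : a ∈ s.layer p)
    (haθ : etaStar S a θ) : ∀ x ∈ s.layer p, etaStar S x θ := by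
  intro x hx
  obtain ⟨b, c, hbc⟩ := s.exists_mul_mul_eq p hx ha
  exact con_of_coe_eq _ haθ hbc (hθ.mul_coe_mul b c)

end PrincipalSeries

end EtaStar

theorem mainTheorem8 {S : Type*} [Semigroup S] [Finite S] (s : EtaStar.PrincipalSeries S)
    (p : Fin s.length) (hp : ¬ EtaStar.IsNull (s.factor p)) :
    (¬ EtaStar.IsCSDiagonal (s.factor p) →
      EtaStar.InZeroClass (s.layer p) ∨
        ∃ q : Fin s.length, p < q ∧
          ∀ x ∈ s.layer p, ∃ y ∈ s.layer q, EtaStar.etaStar S x y) ∧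
    (∀ θ : S, EtaStar.IsZeroElement θ →
      (∃ a ∈ s.layer p, EtaStar.etaStar S a θ) →
        ∀ x ∈ s.layer p, EtaStar.etaStar S x θ) ∧
    ((∀ q : Fin s.length, p ≤ q →
        EtaStar.IsNull (s.factor q) ∨ ¬ EtaStar.IsCSDiagonal (s.factor q)) →
      EtaStar.InZeroClass (s.layer p)) := by
  -- The second alternative always holds: if the layer falls to θ, the layer {θ} can serve as q.
  refine ⟨fun hcs => Or.inr ?_, fun θ hθ ⟨a, ha, haθ⟩ => s.etaStar_zero_of_mem_layer p hθ ha haθ,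
    s.inZeroClass_layer p hp⟩
  obtain ⟨u, hu, v, hv, huv⟩ := s.exists_etaStar_of_not_isCSDiagonal p hp hcs
  obtain ⟨q, hpq, hq, -⟩ := s.exists_lowest_layer p hu hv huv
  exact ⟨q, p.castSucc_lt_succ.trans_le hpq, hq⟩
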